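/- Let $m,n,r\ge 1$ be integers and $M\in\mathbb{R}^{m\times n}$. Equip $\mathbb{R}^{m\times r}\times\mathbb{R}^{r\times n}$ with the Euclidean norm $|(X,Y)|=\sqrt{\|X\|_F^2+\|Y\|_F^2}$, and let $f(X,Y)=\tfrac12\|XY-M\|_F^2$, where $\|\cdot\|_F$ is the Frobenius norm. Let $\|\cdot\|_2$ denote the spectral norm. For a symmetric linear operator $A$, let $\lambda_1(A)$ denote its largest eigenvalue and $E_1(A)$ the corresponding eigenspace. For a point $x$ and $\rho>0$ put $\mathring f(x,\rho)=\sup\{|f(y)-f(x)| : |y-x|\le \rho\}$, and write $x\preceq y$ if there is $\bar \rho>0$ such that $\mathring f(x,\rho)\le \mathring f(y,\rho)$ for all $\rho\in(0,\bar \rho]$. A point $\bar x$ is called *flat* if it has a neighborhood $U$ in the level set $[f=f(\bar x)]$ such that $\bar x\preceq x$ for all $x\in U\setminus\{\bar x\}$, and *globally flat* if $\bar x\preceq x$ for all $x\in[f=f(\bar x)]$. **Proposition.** Suppose $\overline X\in\mathbb{R}^{m\times r}$ and $\overline Y\in\mathbb{R}^{r\times n}$ satisfy $\overline X\,\overline Y=M$.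 The following are equivalent: 1. $(\overline X,\overline Y)$ is globally flat; 2. $(\overline X,\overline Y)$ is flat; 3. $(\overline X,\overline Y)$ is a local minimizer of $(X,Y)\mapsto\lambda_1(\nabla^2 f(X,Y))$ over the set $\{(X,Y): XY=M\}$; 4. $\|\overline X\|_2=\|\overline Y\|_2$ and there exists a nonzero $(\overline H,\overline K)\in E_1(\nabla^2 f(\overline X,\overline Y))$ with $\overline H^T\overline H=\overline K\,\overline K^T$; 5. $(\overline X,\overline Y)$ is a global minimizer of $(X,Y)\mapsto\lambda_1(\nabla^2 f(X,Y))$ over the set $\{(X,Y): XY=M\}$; 6. $\|\overline X\|_2=\|\overline Y\|_2=\sqrt{\|M\|_2}$. -/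

import Mathlib

open scoped Matrix

noncomputable section

namespace MatFac

/-! ### Matrix norms -/

/-- The Frobenius norm of a real matrix. -/
def frobNorm {m n : ℕ} (A : Matrix (Fin m) (Fin n) ℝ) : ℝ :=
  Matrix.frobeniusNormedAddCommGroup.toNorm.norm A

/-- The spectral norm of a real matrix, i.e. its operator norm as a linear map between
Euclidean spaces. -/
def specNorm {m n : ℕ} (A : Matrix (Fin m) (Fin n) ℝ) : ℝ :=
  Matrix.instL2OpNormedAddCommGroup.toNorm.norm A

/-! ### Flatness -/

section Flat

variable {E : Type*} [PseudoMetricSpace E]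

/-- The largest variation of `f` over the closed ball of radius `r` around `x`, namely
the supremum of `|f y - f x|` over that ball, as an element of `[0, ∞]`. -/
def variation (f : E → ℝ) (x : E) (r : ℝ) : ENNReal :=
  ⨆ y ∈ Metric.closedBall x r, ENNReal.ofReal |f y - f x|

/-- The relation "`x` is flatter than `y`, or equally flat": the variation of `f` around `x`
is at most its variation around `y` at all sufficiently small radii. -/
def FlatLE (f : E → ℝ) (x y : E) : Prop :=
  ∃ R : ℝ, 0 < R ∧ ∀ r ∈ Set.Ioc 0 R, variation f x r ≤ variation f y r

/-- `x` is flat: it is related to all the nearby points of its own level set. -/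
def IsFlat (f : E → ℝ) (x : E) : Prop :=
  ∃ U ∈ nhds x, ∀ y ∈ (U ∩ {z | f z = f x}) \ {x}, FlatLE f x y

/-- `x` is globally flat: it is related to all the points of its own level set. -/
def IsGloballyFlat (f : E → ℝ) (x : E) : Prop :=
  ∀ y ∈ {z | f z = f x}, FlatLE f x y

/-- The global minimizers of `g` over `S`. -/
def argMin (g : E → ℝ) (S : Set E) : Set E :=
  {x | x ∈ S ∧ IsMinOn g S x}

/-- The local minimizers of `g` over `S`, with respect to the subspace topology on `S`. -/
def argLocMin (g : E → ℝ) (S : Set E) : Set E :=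
  {x | x ∈ S ∧ IsLocalMinOn g S x}

end Flat

/-! ### The Hessian, its maximal eigenvalue and the corresponding eigenspace -/

section Hessian

variable {E : Type*} [NormedAddCommGroup E] [InnerProductSpace ℝ E] [CompleteSpace E]

/-- The Hessian of `f` at `x`, as a linear operator: the derivative of the gradient. -/
def hessian (f : E → ℝ) (x : E) : E →ₗ[ℝ] E :=
  (fderiv ℝ (gradient f) x).toLinearMap

/-- The operator just defined represents the second derivative of `f`. -/
theorem inner_hessian (f : E → ℝ) (x v w : E) (hf : DifferentiableAt ℝ (fderiv ℝ f) x) :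
    inner ℝ (hessian f x v) w = fderiv ℝ (fderiv ℝ f) x v w := by
  let L : (E →L[ℝ] ℝ) →L[ℝ] E :=
    { toFun := fun φ => (InnerProductSpace.toDual ℝ E).symm φ
      map_add' := fun φ ψ => map_add _ φ ψ
      map_smul' := fun c φ => by simp
      cont := (InnerProductSpace.toDual ℝ E).symm.continuous }
  have h : HasFDerivAt (gradient f) (L.comp (fderiv ℝ (fderiv ℝ f) x)) x :=
    L.hasFDerivAt.comp x hf.hasFDerivAt
  unfold hessian
  rw [h.fderiv]
  exact InnerProductSpace.toDual_symm_apply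

/-- The largest eigenvalue `λ₁` of a linear operator; for a symmetric operator on a nonzero
finite-dimensional space, the set of eigenvalues is finite and nonempty, so that the supremum
is a maximum. -/
def maxEigenvalue (T : E →ₗ[ℝ] E) : ℝ :=
  sSup {μ : ℝ | Module.End.HasEigenvalue T μ}

/-- The eigenspace `E₁` of the largest eigenvalue. -/
def maxEigenspace (T : E →ₗ[ℝ] E) : Submodule ℝ E :=
  Module.End.eigenspace T (maxEigenvalue T)

end Hessian

/-! ### Matrix factorization -/

/-- The Euclidean space of pairs `(X, Y)` of an `m × r` matrix and an `r × n` matrix: the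
entries of both matrices are the coordinates, so the squared norm is the sum of the squared
Frobenius norms of `X` and `Y`. -/
abbrev PairSpace (m r n : ℕ) : Type :=
  EuclideanSpace ℝ ((Fin m × Fin r) ⊕ (Fin r × Fin n))

variable {m r n : ℕ}

/-- The pair `(X, Y)` as a point of the Euclidean space. -/
def pair (X : Matrix (Fin m) (Fin r) ℝ) (Y : Matrix (Fin r) (Fin n) ℝ) : PairSpace m r n :=
  WithLp.toLp 2 (Sum.elim (fun a => X a.1 a.2) (fun b => Y b.1 b.2))

/-- The first matrix of a pair. -/
def left (p : PairSpace m r n) : Matrix (Fin m) (Fin r) ℝ :=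
  Matrix.of fun i j => p (Sum.inl (i, j))

/-- The second matrix of a pair. -/
def right (p : PairSpace m r n) : Matrix (Fin r) (Fin n) ℝ :=
  Matrix.of fun i j => p (Sum.inr (i, j))

/-- The objective function `f(X, Y) = ‖XY - M‖_F² / 2`. -/
def objective (M : Matrix (Fin m) (Fin n) ℝ) (p : PairSpace m r n) : ℝ :=
  frobNorm (left p * right p - M) ^ 2 / 2

/-- The set of all `(X, Y)` with `XY = M`. -/
def solutionSet (r : ℕ) (M : Matrix (Fin m) (Fin n) ℝ) : Set (PairSpace m r n) :=
  {p | left p * right p = M}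

end MatFac

end

namespace MatFac

/-! ### The Frobenius inner product and the two norms -/

/-! At a solution the residual vanishes, so `f (p + v) = ‖L v + H K‖² / 2` exactly, where `v = (H,
K)` and `L v = X K + H Y` (`tangent`). Hence the Hessian is the Gram operator of `L`, and its
largest eigenvalue is `‖L‖² = ‖X‖₂² + ‖Y‖₂²` (`maxEigenvalue_hessian_objective`). Since `‖M‖₂ ≤ ‖X‖₂
‖Y‖₂`, this is at least `2 ‖M‖₂`, with equality under condition 6.

Flatness is governed by `g = ‖L‖` (`gain`): as `‖H K‖ ≤ ‖v‖² / 2`, the variation at radius `ρ` lies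
between `(g ρ - ρ²/2)² / 2` and `(g ρ + ρ²/2)² / 2`, so a smaller gain means strictly smaller
variation at small radii (`exists_variation_lt`). This makes flat points local minimizers. Ties in
the gain are settled at balanced points, where the upper bound is attained
(`le_variation_objective_of_balanced`).

The substantial implication is from local minimality to condition 6. Rescaling the factors gives
`‖X‖₂ = ‖Y‖₂ = σ`. If `‖M‖₂ < σ²`, no vector is a leading right singular vector of both `X` and
`Yᵀ`; moving along `(X G, G⁻¹ Y)` with `G = 1 + t (Y Yᵀ - Xᵀ X)` then decreases both spectral norms
(`sq_le_specNorm_of_isLocalMinOn`). Condition 4 expresses the same compatibility of singular vectors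
through the eigenspace. The implications shown are 1 → 2 → 3 → 6 → 1, 6 → 5 → 3 and 4 ↔ 6. -/

/-- The Frobenius inner product. -/
def frobInner {m n : ℕ} (A B : Matrix (Fin m) (Fin n) ℝ) : ℝ := (Aᵀ * B).trace

section Norms

variable {k l m n : ℕ}

theorem frobInner_eq_sum (A B : Matrix (Fin m) (Fin n) ℝ) :
    frobInner A B = ∑ i, ∑ j, A i j * B i j := by
  rw [Finset.sum_comm]
  simp [frobInner, Matrix.trace, Matrix.mul_apply]

theorem frobInner_comm (A B : Matrix (Fin m) (Fin n) ℝ) : frobInner A B = frobInner B A := by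
  simp [frobInner_eq_sum, mul_comm]

theorem frobInner_add_left (A B C : Matrix (Fin m) (Fin n) ℝ) :
    frobInner (A + B) C = frobInner A C + frobInner B C := by
  simp [frobInner, Matrix.add_mul]

theorem frobInner_add_right (A B C : Matrix (Fin m) (Fin n) ℝ) :
    frobInner A (B + C) = frobInner A B + frobInner A C := by
  simp [frobInner, Matrix.mul_add]

theorem frobInner_sub_left (A B C : Matrix (Fin m) (Fin n) ℝ) :
    frobInner (A - B) C = frobInner A C - frobInner B C := by
  simp [frobInner, Matrix.sub_mul]

theorem frobInner_sub_right (A B C : Matrix (Fin m) (Fin n) ℝ) :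
    frobInner A (B - C) = frobInner A B - frobInner A C := by
  simp [frobInner, Matrix.mul_sub]

theorem frobInner_smul_left (c : ℝ) (A B : Matrix (Fin m) (Fin n) ℝ) :
    frobInner (c • A) B = c * frobInner A B := by
  simp [frobInner]

theorem frobInner_smul_right (c : ℝ) (A B : Matrix (Fin m) (Fin n) ℝ) :
    frobInner A (c • B) = c * frobInner A B := by
  simp [frobInner]

theorem frobInner_mul_left (A : Matrix (Fin k) (Fin m) ℝ) (B : Matrix (Fin m) (Fin n) ℝ)
    (C : Matrix (Fin k) (Fin n) ℝ) : frobInner (A * B) C = frobInner B (Aᵀ * C) := by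
  simp [frobInner, Matrix.mul_assoc]

theorem frobInner_mul_right (A : Matrix (Fin k) (Fin m) ℝ) (B : Matrix (Fin m) (Fin n) ℝ)
    (C : Matrix (Fin k) (Fin n) ℝ) : frobInner (A * B) C = frobInner A (C * Bᵀ) := by
  rw [frobInner, frobInner, Matrix.transpose_mul, Matrix.mul_assoc, Matrix.trace_mul_comm,
    Matrix.mul_assoc]

theorem frobNorm_nonneg (A : Matrix (Fin m) (Fin n) ℝ) : 0 ≤ frobNorm A := by
  open scoped Matrix.Norms.Frobenius in exact norm_nonneg A

theorem specNorm_nonneg (A : Matrix (Fin m) (Fin n) ℝ) : 0 ≤ specNorm A := by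
  open scoped Matrix.Norms.L2Operator in exact norm_nonneg A

theorem frobNorm_add_le (A B : Matrix (Fin m) (Fin n) ℝ) :
    frobNorm (A + B) ≤ frobNorm A + frobNorm B := by
  open scoped Matrix.Norms.Frobenius in exact norm_add_le A B

theorem frobNorm_smul (c : ℝ) (A : Matrix (Fin m) (Fin n) ℝ) :
    frobNorm (c • A) = |c| * frobNorm A := by
  open scoped Matrix.Norms.Frobenius in exact norm_smul c A

theorem frobNorm_transpose (A : Matrix (Fin m) (Fin n) ℝ) : frobNorm Aᵀ = frobNorm A := by
  open scoped Matrix.Norms.Frobenius in exact Matrix.frobenius_norm_transpose A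

theorem frobNorm_mul_le (A : Matrix (Fin k) (Fin m) ℝ) (B : Matrix (Fin m) (Fin n) ℝ) :
    frobNorm (A * B) ≤ frobNorm A * frobNorm B := by
  open scoped Matrix.Norms.Frobenius in exact Matrix.frobenius_norm_mul A B

theorem frobNorm_eq_zero {A : Matrix (Fin m) (Fin n) ℝ} : frobNorm A = 0 ↔ A = 0 := by
  open scoped Matrix.Norms.Frobenius in exact norm_eq_zero (a := A)

theorem frobNorm_sq (A : Matrix (Fin m) (Fin n) ℝ) : frobNorm A ^ 2 = ∑ i, ∑ j, A i j ^ 2 := by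
  have h : frobNorm A = (∑ i, ∑ j, ‖A i j‖ ^ 2) ^ (1 / 2 : ℝ) := by
    open scoped Matrix.Norms.Frobenius in
    have := Matrix.frobenius_norm_def A
    simp only [Real.rpow_ofNat] at this
    exact this
  rw [h, ← Real.sqrt_eq_rpow, Real.sq_sqrt (by positivity)]
  simp

theorem frobInner_self (A : Matrix (Fin m) (Fin n) ℝ) : frobInner A A = frobNorm A ^ 2 := by
  rw [frobInner_eq_sum, frobNorm_sq]
  simp [sq]

theorem frobNorm_add_sq (A B : Matrix (Fin m) (Fin n) ℝ) :
    frobNorm (A + B) ^ 2 = frobNorm A ^ 2 + 2 * frobInner A B + frobNorm B ^ 2 := by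
  simp only [← frobInner_self, frobInner_add_left, frobInner_add_right, frobInner_comm B A]
  ring

theorem frobNorm_sub_sq (A B : Matrix (Fin m) (Fin n) ℝ) :
    frobNorm (A - B) ^ 2 = frobNorm A ^ 2 - 2 * frobInner A B + frobNorm B ^ 2 := by
  simp only [← frobInner_self, frobInner_sub_left, frobInner_sub_right, frobInner_comm B A]
  ring

theorem specNorm_transpose (A : Matrix (Fin m) (Fin n) ℝ) : specNorm Aᵀ = specNorm A := by
  open scoped Matrix.Norms.L2Operator in
  have := Matrix.l2_opNorm_conjTranspose A
  rw [Matrix.conjTranspose_eq_transpose_of_trivial] at this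
  exact this

theorem specNorm_mul_le (A : Matrix (Fin k) (Fin m) ℝ) (B : Matrix (Fin m) (Fin n) ℝ) :
    specNorm (A * B) ≤ specNorm A * specNorm B := by
  open scoped Matrix.Norms.L2Operator in exact Matrix.l2_opNorm_mul A B

theorem specNorm_smul (c : ℝ) (A : Matrix (Fin m) (Fin n) ℝ) :
    specNorm (c • A) = |c| * specNorm A := by
  open scoped Matrix.Norms.L2Operator in exact norm_smul c A

/-- The column with given entries. -/
def column (v : EuclideanSpace ℝ (Fin n)) : Matrix (Fin n) (Fin 1) ℝ := Matrix.of fun i _ => v i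

theorem frobNorm_column (v : EuclideanSpace ℝ (Fin n)) : frobNorm (column v) = ‖v‖ := by
  rw [← sq_eq_sq₀ (frobNorm_nonneg _) (norm_nonneg _), frobNorm_sq, EuclideanSpace.norm_sq_eq]
  simp [column]

theorem mul_column (A : Matrix (Fin m) (Fin n) ℝ) (v : EuclideanSpace ℝ (Fin n)) :
    A * column v = column (WithLp.toLp 2 (A *ᵥ v.ofLp)) := by
  ext i j
  simp [column, Matrix.mul_apply, Matrix.mulVec, dotProduct]

theorem frobNorm_mul_column_le (A : Matrix (Fin m) (Fin n) ℝ) (v : EuclideanSpace ℝ (Fin n)) :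
    frobNorm (A * column v) ≤ specNorm A * ‖v‖ := by
  open scoped Matrix.Norms.L2Operator in
  rw [mul_column, frobNorm_column]
  exact Matrix.l2_opNorm_mulVec A v

theorem frobNorm_mul_sq_eq_sum (A : Matrix (Fin m) (Fin n) ℝ) (B : Matrix (Fin n) (Fin k) ℝ) :
    frobNorm (A * B) ^ 2 = ∑ j, frobNorm (A * column (WithLp.toLp 2 fun i => B i j)) ^ 2 := by
  simp only [frobNorm_sq]
  rw [Finset.sum_comm]
  simp [column, Matrix.mul_apply]

theorem frobNorm_mul_le_specNorm_mul (A : Matrix (Fin m) (Fin n) ℝ)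
    (B : Matrix (Fin n) (Fin k) ℝ) : frobNorm (A * B) ≤ specNorm A * frobNorm B := by
  have hA := specNorm_nonneg A
  have hB := frobNorm_nonneg B
  rw [← sq_le_sq₀ (frobNorm_nonneg _) (by positivity), frobNorm_mul_sq_eq_sum, mul_pow,
    frobNorm_sq B, Finset.sum_comm, Finset.mul_sum]
  refine Finset.sum_le_sum fun j _ => ?_
  refine (pow_le_pow_left₀ (frobNorm_nonneg _) (frobNorm_mul_column_le A _) 2).trans_eq ?_
  rw [mul_pow, EuclideanSpace.norm_sq_eq]
  simp

theorem frobNorm_mul_le_mul_specNorm (A : Matrix (Fin m) (Fin n) ℝ)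
    (B : Matrix (Fin n) (Fin k) ℝ) : frobNorm (A * B) ≤ frobNorm A * specNorm B := by
  rw [← frobNorm_transpose, Matrix.transpose_mul, mul_comm, ← specNorm_transpose,
    ← frobNorm_transpose A]
  exact frobNorm_mul_le_specNorm_mul _ _

/-- The spectral norm is attained at some unit vector. -/
theorem exists_frobNorm_mul_column_eq (hn : 0 < n) (A : Matrix (Fin m) (Fin n) ℝ) :
    ∃ v : EuclideanSpace ℝ (Fin n), ‖v‖ = 1 ∧ frobNorm (A * column v) = specNorm A := by
  have : Nonempty (Fin n) := ⟨⟨0, hn⟩⟩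
  have hne : (Metric.sphere (0 : EuclideanSpace ℝ (Fin n)) 1).Nonempty :=
    NormedSpace.sphere_nonempty.2 zero_le_one
  let T := (Matrix.toEuclideanLin (𝕜 := ℝ) A).toContinuousLinearMap
  obtain ⟨v, hv, hmax⟩ := (isCompact_sphere (0 : EuclideanSpace ℝ (Fin n)) 1).exists_isMaxOn hne
    (f := fun v => ‖T v‖) (by fun_prop)
  have hT : ∀ w, frobNorm (A * column w) = ‖T w‖ := fun w => by
    rw [mul_column, frobNorm_column]; rfl
  have hv1 : ‖v‖ = 1 := by simpa using hv
  refine ⟨v, hv1, le_antisymm (by simpa [hv1] using frobNorm_mul_column_le A v) ?_⟩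
  have hle : ‖T‖ ≤ ‖T v‖ := by
    refine T.opNorm_le_of_unit_norm (norm_nonneg _) fun w hw => ?_
    exact hmax (by simpa using hw)
  rw [hT]
  exact hle

theorem exists_frobNorm_mul_eq (hn : 0 < n) (A : Matrix (Fin m) (Fin n) ℝ) :
    ∃ v : Matrix (Fin n) (Fin 1) ℝ, frobNorm v = 1 ∧ frobNorm (A * v) = specNorm A := by
  obtain ⟨v, hv, hA⟩ := exists_frobNorm_mul_column_eq hn A
  exact ⟨column v, by rw [frobNorm_column, hv], hA⟩

/-- Equality in `‖AB‖ ≤ ‖A‖₂ ‖B‖` means that the columns of `B` are eigenvectors of `AᵀA`. -/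
theorem transpose_mul_mul_eq (A : Matrix (Fin m) (Fin n) ℝ) (B : Matrix (Fin n) (Fin k) ℝ)
    (h : frobNorm (A * B) = specNorm A * frobNorm B) :
    Aᵀ * (A * B) = specNorm A ^ 2 • B := by
  rw [← sub_eq_zero, ← frobNorm_eq_zero, ← sq_eq_zero_iff]
  refine le_antisymm ?_ (sq_nonneg _)
  -- With `s = ‖A‖₂`, the squared distance expands to `‖AᵀAB‖² - 2 s² ‖AB‖² + s⁴ ‖B‖²`, which is at
  -- most `s⁴ ‖B‖² (1 - 2 + 1) = 0`.
  have h1 : frobNorm (Aᵀ * (A * B)) ≤ specNorm A * (specNorm A * frobNorm B) := by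
    rw [← h, ← specNorm_transpose A]
    exact frobNorm_mul_le_specNorm_mul _ _
  have h2 := pow_le_pow_left₀ (frobNorm_nonneg _) h1 2
  have h3 : frobInner (Aᵀ * (A * B)) B = frobNorm (A * B) ^ 2 := by
    rw [frobInner_mul_left, Matrix.transpose_transpose, frobInner_self]
  rw [frobNorm_sub_sq, frobInner_smul_right, h3, frobNorm_smul, h, abs_of_nonneg (sq_nonneg _)]
  nlinarith

theorem transpose_mul_self_eq_one {v : Matrix (Fin n) (Fin 1) ℝ} (h : frobNorm v = 1) :
    vᵀ * v = 1 := by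
  have := frobInner_self v
  rw [frobInner, h, Matrix.trace_fin_one] at this
  ext i j
  rw [Subsingleton.elim i 0, Subsingleton.elim j 0, this]
  simp

theorem frobNorm_unit_mul {v : Matrix (Fin n) (Fin 1) ℝ} (h : frobNorm v = 1)
    (A : Matrix (Fin 1) (Fin k) ℝ) : frobNorm (v * A) = frobNorm A := by
  rw [← sq_eq_sq₀ (frobNorm_nonneg _) (frobNorm_nonneg _), ← frobInner_self, frobInner_mul_left,
    ← Matrix.mul_assoc, transpose_mul_self_eq_one h, Matrix.one_mul, frobInner_self]

theorem frobNorm_unit_mul_unit {v : Matrix (Fin n) (Fin 1) ℝ} (hv : frobNorm v = 1)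
    {w : Matrix (Fin k) (Fin 1) ℝ} (hw : frobNorm w = 1) : frobNorm (v * wᵀ) = 1 := by
  rw [frobNorm_unit_mul hv, frobNorm_transpose, hw]

end Norms

end MatFac

namespace MatFac

/-! ### The Hessian of a squared norm of a quadratic map -/

section QuadraticMap

variable {E W : Type*} [NormedAddCommGroup E] [InnerProductSpace ℝ E] [CompleteSpace E]
  [NormedAddCommGroup W] [InnerProductSpace ℝ W]

/-- At a zero of a quadratic map, the Hessian of half its squared norm is the Gauss-Newton
operator. -/
theorem inner_hessian_half_normSq (β : E →L[ℝ] E →L[ℝ] W) (c : W) (x : E) (hx : β x x = c)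
    (v w : E) : inner ℝ (hessian (fun p => ‖β p p - c‖ ^ 2 / 2) x v) w =
      inner ℝ (β x v + β v x) (β x w + β w x) := by
  set f : E → ℝ := fun p => ‖β p p - c‖ ^ 2 / 2 with hf
  have hg : ∀ p, HasFDerivAt (fun p => β p p - c) (β p + β.flip p) p := fun p => by
    refine ((β.hasFDerivAt_of_bilinear (hasFDerivAt_id p) (hasFDerivAt_id p)).sub_const
      c).congr_fderiv ?_
    ext u
    simp
  have hfd : ∀ p u, fderiv ℝ f p u = inner ℝ (β p p - c) (β p u + β u p) := fun p u => by
    have := ((hg p).norm_sq).const_mul (1 / 2 : ℝ)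
    have h2 : f = fun p => 1 / 2 * ‖β p p - c‖ ^ 2 := by
      ext p
      simp only [hf]
      ring
    rw [h2, this.fderiv]
    simp [inner_sub_left, inner_add_right]
  have hsmooth : ContDiff ℝ 2 f := by
    refine ((ContDiff.norm_sq ℝ ?_).div_const 2)
    fun_prop
  have hdiff : DifferentiableAt ℝ (fderiv ℝ f) x :=
    (hsmooth.fderiv_right (m := 1) (by norm_num)).differentiable (by norm_num) x
  rw [inner_hessian f x v w hdiff]
  have h1 : fderiv ℝ (fderiv ℝ f) x v w = fderiv ℝ (fun p => fderiv ℝ f p w) x v := by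
    have := (hdiff.hasFDerivAt.clm_apply (hasFDerivAt_const w x)).fderiv
    rw [this]
    simp
  have h2 : HasFDerivAt (fun p => β p w + β w p) (β.flip w + β w) x :=
    ((β.flip w).hasFDerivAt).add (β w).hasFDerivAt
  rw [h1, funext fun p => hfd p w, ((hg x).inner ℝ h2).fderiv]
  -- The second derivative of the quadratic map is paired with the residual `β x x - c`, which is
  -- zero here; only the product of first derivatives survives.
  simp [hx]

end QuadraticMap

/-! ### Largest eigenvalue of a Gram operator -/

section Gram

variable {E W : Type*} [NormedAddCommGroup E] [InnerProductSpace ℝ E]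
  [NormedAddCommGroup W] [InnerProductSpace ℝ W]

/-- The quadratic form `s ‖v‖² - ‖L v‖²` is nonnegative, so a vector where it vanishes is in the
kernel of the associated bilinear form. -/
theorem gram_apply_eq_smul {T : E →ₗ[ℝ] E} {L : E →ₗ[ℝ] W} {s : ℝ}
    (hT : ∀ v w, inner ℝ (T v) w = inner ℝ (L v) (L w)) (hs : ∀ v, ‖L v‖ ^ 2 ≤ s * ‖v‖ ^ 2)
    {v : E} (hv : ‖L v‖ ^ 2 = s * ‖v‖ ^ 2) : T v = s • v := by
  refine ext_inner_right ℝ fun w => ?_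
  rw [hT, inner_smul_left]
  -- The form at `v + t w` is a nonnegative polynomial in `t` without constant term, so its linear
  -- coefficient is zero.
  have key : ∀ t : ℝ, 0 ≤ (s * ‖w‖ ^ 2 - ‖L w‖ ^ 2) * (t * t) +
      2 * (s * inner ℝ v w - inner ℝ (L v) (L w)) * t + 0 := fun t => by
    have := hs (v + t • w)
    rw [map_add, map_smul, norm_add_sq_real, norm_add_sq_real, inner_smul_right,
      inner_smul_right, norm_smul, norm_smul, mul_pow, mul_pow, Real.norm_eq_abs, sq_abs, hv]
      at this
    nlinarith
  have := discrim_le_zero key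
  rw [discrim] at this
  have h0 : s * inner ℝ v w - inner ℝ (L v) (L w) = 0 := by
    refine sq_eq_zero_iff.1 (le_antisymm ?_ (sq_nonneg _))
    nlinarith
  simp only [conj_trivial]
  linarith

/-- Every eigenvalue is the Rayleigh quotient of its eigenvector, hence at most `s`; a vector
attaining the bound is an eigenvector for `s`. -/
theorem maxEigenvalue_gram {T : E →ₗ[ℝ] E} {L : E →ₗ[ℝ] W} {s : ℝ}
    (hT : ∀ v w, inner ℝ (T v) w = inner ℝ (L v) (L w)) (hs : ∀ v, ‖L v‖ ^ 2 ≤ s * ‖v‖ ^ 2)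
    (hv : ∃ v, v ≠ 0 ∧ ‖L v‖ ^ 2 = s * ‖v‖ ^ 2) : maxEigenvalue T = s := by
  obtain ⟨v, hv0, hv⟩ := hv
  refine IsGreatest.csSup_eq ⟨?_, ?_⟩
  · exact Module.End.hasEigenvalue_of_hasEigenvector
      ⟨Module.End.mem_eigenspace_iff.2 (gram_apply_eq_smul hT hs hv), hv0⟩
  · intro μ hμ
    obtain ⟨w, hw, hw0⟩ := hμ.exists_hasEigenvector
    have h1 := hT w w
    rw [Module.End.mem_eigenspace_iff.1 hw, inner_smul_left, real_inner_self_eq_norm_sq,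
      real_inner_self_eq_norm_sq] at h1
    simp only [conj_trivial] at h1
    have h2 : 0 < ‖w‖ ^ 2 := by positivity
    exact le_of_mul_le_mul_right (h1.trans_le (hs w)) h2

theorem mem_maxEigenspace_gram {T : E →ₗ[ℝ] E} {L : E →ₗ[ℝ] W} {s : ℝ}
    (hT : ∀ v w, inner ℝ (T v) w = inner ℝ (L v) (L w)) (hs : ∀ v, ‖L v‖ ^ 2 ≤ s * ‖v‖ ^ 2)
    (hv : ∃ v, v ≠ 0 ∧ ‖L v‖ ^ 2 = s * ‖v‖ ^ 2) {w : E} :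
    w ∈ maxEigenspace T ↔ ‖L w‖ ^ 2 = s * ‖w‖ ^ 2 := by
  rw [maxEigenspace, maxEigenvalue_gram hT hs hv, Module.End.mem_eigenspace_iff]
  refine ⟨fun h => ?_, gram_apply_eq_smul hT hs⟩
  rw [← real_inner_self_eq_norm_sq, ← hT, h, inner_smul_left, real_inner_self_eq_norm_sq]
  simp

end Gram

/-! ### The space of pairs -/

section Pair

variable {m r n : ℕ}

@[simp]
theorem left_pair (X : Matrix (Fin m) (Fin r) ℝ) (Y : Matrix (Fin r) (Fin n) ℝ) :
    left (pair X Y) = X := rfl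

@[simp]
theorem right_pair (X : Matrix (Fin m) (Fin r) ℝ) (Y : Matrix (Fin r) (Fin n) ℝ) :
    right (pair X Y) = Y := rfl

theorem left_add (p q : PairSpace m r n) : left (p + q) = left p + left q := rfl

theorem right_add (p q : PairSpace m r n) : right (p + q) = right p + right q := rfl

theorem left_smul (c : ℝ) (p : PairSpace m r n) : left (c • p) = c • left p := rfl

theorem right_smul (c : ℝ) (p : PairSpace m r n) : right (c • p) = c • right p := rfl

theorem norm_sq_pairSpace (p : PairSpace m r n) :
    ‖p‖ ^ 2 = frobNorm (left p) ^ 2 + frobNorm (right p) ^ 2 := by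
  rw [EuclideanSpace.norm_sq_eq, Fintype.sum_sum_type, Fintype.sum_prod_type,
    Fintype.sum_prod_type, frobNorm_sq, frobNorm_sq]
  simp [left, right]

/-- A matrix as a point of the Euclidean space of its entries. -/
def flatten : Matrix (Fin m) (Fin n) ℝ →ₗ[ℝ] EuclideanSpace ℝ (Fin m × Fin n) where
  toFun A := WithLp.toLp 2 fun a => A a.1 a.2
  map_add' _ _ := rfl
  map_smul' _ _ := rfl

theorem norm_flatten (A : Matrix (Fin m) (Fin n) ℝ) : ‖flatten A‖ = frobNorm A := by
  rw [← sq_eq_sq₀ (norm_nonneg _) (frobNorm_nonneg _), EuclideanSpace.norm_sq_eq,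
    Fintype.sum_prod_type, frobNorm_sq]
  simp only [Real.norm_eq_abs, sq_abs]
  rfl

/-- The product `left p * right q`, as a continuous bilinear map. -/
noncomputable def productBilin (m r n : ℕ) :
    PairSpace m r n →L[ℝ] PairSpace m r n →L[ℝ] EuclideanSpace ℝ (Fin m × Fin n) :=
  (LinearMap.mk₂ ℝ (fun p q : PairSpace m r n => flatten (left p * right q))
    (fun p p' q => by rw [left_add, Matrix.add_mul, map_add])
    (fun c p q => by rw [left_smul, Matrix.smul_mul, map_smul])
    (fun p q q' => by rw [right_add, Matrix.mul_add, map_add])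
    (fun c p q => by rw [right_smul, Matrix.mul_smul, map_smul])).toContinuousBilinearMap

theorem productBilin_apply (p q : PairSpace m r n) :
    productBilin m r n p q = flatten (left p * right q) := rfl

/-- The derivative of `(X, Y) ↦ XY`, in flattened form. -/
noncomputable def tangent (p : PairSpace m r n) : PairSpace m r n →ₗ[ℝ] EuclideanSpace ℝ (Fin m × Fin n) :=
  (productBilin m r n p + (productBilin m r n).flip p).toLinearMap

theorem norm_tangent (p v : PairSpace m r n) :
    ‖tangent p v‖ = frobNorm (left p * right v + left v * right p) := by
  rw [← norm_flatten, map_add]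
  rfl

theorem inner_hessian_objective {M : Matrix (Fin m) (Fin n) ℝ} {p : PairSpace m r n}
    (hp : p ∈ solutionSet r M) (v w : PairSpace m r n) :
    inner ℝ (hessian (objective M) p v) w = inner ℝ (tangent p v) (tangent p w) := by
  have : objective M = fun q : PairSpace m r n =>
      ‖productBilin m r n q q - flatten M‖ ^ 2 / 2 := by
    ext q
    rw [productBilin_apply, ← map_sub, norm_flatten, objective]
  rw [this]
  refine inner_hessian_half_normSq _ _ p ?_ v w
  rw [productBilin_apply, show left p * right p = M from hp]

end Pair

end MatFac

namespace MatFac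

/-! ### The largest eigenvalue of the Hessian on the solution set -/

section Eigenvalue

variable {m r n : ℕ}

theorem exists_frobNorm_eq_one (hn : 0 < n) : ∃ v : Matrix (Fin n) (Fin 1) ℝ, frobNorm v = 1 :=
  (exists_frobNorm_mul_eq hn (0 : Matrix (Fin n) (Fin n) ℝ)).imp fun _ h => h.1

theorem mul_eq_zero_of_specNorm_eq_zero {k : ℕ} {A : Matrix (Fin m) (Fin n) ℝ}
    (h : specNorm A = 0) (B : Matrix (Fin n) (Fin k) ℝ) : A * B = 0 := by
  have := frobNorm_mul_le_specNorm_mul A B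
  rw [h, zero_mul] at this
  exact frobNorm_eq_zero.1 (le_antisymm this (frobNorm_nonneg _))

theorem frobNorm_smul_eq_one {k : ℕ} {c : ℝ} (hc : 0 < c) {A : Matrix (Fin m) (Fin k) ℝ}
    (h : frobNorm A = c) : frobNorm (c⁻¹ • A) = 1 := by
  rw [frobNorm_smul, h, abs_of_pos (inv_pos.2 hc), inv_mul_cancel₀ hc.ne']

/-- Existence of a leading pair of singular vectors. -/
theorem exists_singular_pair (hm : 0 < m) (hn : 0 < n) (A : Matrix (Fin m) (Fin n) ℝ) :
    ∃ (p : Matrix (Fin m) (Fin 1) ℝ) (v : Matrix (Fin n) (Fin 1) ℝ),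
      frobNorm p = 1 ∧ frobNorm v = 1 ∧ A * v = specNorm A • p ∧ Aᵀ * p = specNorm A • v := by
  rcases (specNorm_nonneg A).eq_or_lt with h0 | h0
  · obtain ⟨p, hp⟩ := exists_frobNorm_eq_one hm
    obtain ⟨v, hv⟩ := exists_frobNorm_eq_one hn
    refine ⟨p, v, hp, hv, ?_, ?_⟩
    · rw [mul_eq_zero_of_specNorm_eq_zero h0.symm, ← h0, zero_smul]
    · rw [mul_eq_zero_of_specNorm_eq_zero ((specNorm_transpose A).trans h0.symm), ← h0, zero_smul]
  · obtain ⟨v, hv, hA⟩ := exists_frobNorm_mul_eq hn A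
    refine ⟨(specNorm A)⁻¹ • (A * v), v, frobNorm_smul_eq_one h0 hA, hv, ?_, ?_⟩
    · rw [smul_inv_smul₀ h0.ne']
    · rw [Matrix.mul_smul, transpose_mul_mul_eq A v (by rw [hA, hv, mul_one]), smul_smul]
      congr 1
      field_simp

theorem frobNorm_tangent_le (X H : Matrix (Fin m) (Fin r) ℝ) (Y K : Matrix (Fin r) (Fin n) ℝ) :
    frobNorm (X * K + H * Y) ^ 2 ≤
      (specNorm X ^ 2 + specNorm Y ^ 2) * (frobNorm H ^ 2 + frobNorm K ^ 2) := by
  have h : frobNorm (X * K + H * Y) ≤ specNorm X * frobNorm K + frobNorm H * specNorm Y :=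
    (frobNorm_add_le _ _).trans (add_le_add (frobNorm_mul_le_specNorm_mul _ _)
      (frobNorm_mul_le_mul_specNorm _ _))
  refine (pow_le_pow_left₀ (frobNorm_nonneg _) h 2).trans ?_
  -- This square is exactly the defect in the Cauchy-Schwarz inequality.
  nlinarith [sq_nonneg (specNorm X * frobNorm H - specNorm Y * frobNorm K)]

/-- Equality in `frobNorm_tangent_le` is reached by rank-one matrices `H = β p uᵀ` and `K = α v qᵀ`,
built from leading singular vectors, with `(α, β)` parallel to `(‖X‖₂, ‖Y‖₂)`: both terms are then
multiples of `p qᵀ`. The inner vectors `u` and `v` need not agree; balancedness is what allows `u =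
v`. -/
theorem exists_frobNorm_tangent_eq (hm : 0 < m) (hn : 0 < n) (hr : 0 < r)
    (X : Matrix (Fin m) (Fin r) ℝ) (Y : Matrix (Fin r) (Fin n) ℝ) :
    ∃ (H : Matrix (Fin m) (Fin r) ℝ) (K : Matrix (Fin r) (Fin n) ℝ),
      frobNorm H ^ 2 + frobNorm K ^ 2 = 1 ∧
      frobNorm (X * K + H * Y) ^ 2 = specNorm X ^ 2 + specNorm Y ^ 2 := by
  obtain ⟨p, v, hp, hv, hXv, -⟩ := exists_singular_pair hm hr X
  obtain ⟨u, q, hu, hq, -, hYu⟩ := exists_singular_pair hr hn Y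
  obtain ⟨α, β, h1, h2⟩ : ∃ α β : ℝ, α ^ 2 + β ^ 2 = 1 ∧
      (specNorm X * α + specNorm Y * β) ^ 2 = specNorm X ^ 2 + specNorm Y ^ 2 := by
    rcases (add_nonneg (sq_nonneg (specNorm X)) (sq_nonneg (specNorm Y))).eq_or_lt with h | h
    · have hX : specNorm X = 0 := by nlinarith [sq_nonneg (specNorm X), sq_nonneg (specNorm Y)]
      have hY : specNorm Y = 0 := by nlinarith [sq_nonneg (specNorm X), sq_nonneg (specNorm Y)]
      exact ⟨1, 0, by norm_num, by rw [hX, hY]; norm_num⟩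
    · have hs := Real.sq_sqrt h.le
      have hs0 := Real.sqrt_pos.2 h
      set s := √(specNorm X ^ 2 + specNorm Y ^ 2)
      refine ⟨specNorm X / s, specNorm Y / s, ?_, ?_⟩
      · rw [div_pow, div_pow, ← add_div, ← hs, div_self (by positivity)]
      · have : specNorm X * (specNorm X / s) + specNorm Y * (specNorm Y / s) = s := by
          field_simp
          linarith
        rw [this, hs]
  have hYu' : uᵀ * Y = specNorm Y • qᵀ := by
    rw [← Matrix.transpose_smul, ← hYu, Matrix.transpose_mul, Matrix.transpose_transpose]
  refine ⟨β • (p * uᵀ), α • (v * qᵀ), ?_, ?_⟩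
  · rw [frobNorm_smul, frobNorm_smul, frobNorm_unit_mul_unit hp hu, frobNorm_unit_mul_unit hv hq,
      mul_one, mul_one, sq_abs, sq_abs, add_comm, h1]
  · have : X * (α • (v * qᵀ)) + (β • (p * uᵀ)) * Y =
        (specNorm X * α + specNorm Y * β) • (p * qᵀ) := by
      rw [Matrix.mul_smul, ← Matrix.mul_assoc, hXv, Matrix.smul_mul, Matrix.smul_mul,
        Matrix.mul_assoc, hYu', Matrix.mul_smul, smul_smul, smul_smul, add_smul, mul_comm α,
        mul_comm β]
    rw [this, frobNorm_smul, frobNorm_unit_mul_unit hp hq, mul_one, sq_abs, h2]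

theorem norm_tangent_sq_le (p v : PairSpace m r n) :
    ‖tangent p v‖ ^ 2 ≤ (specNorm (left p) ^ 2 + specNorm (right p) ^ 2) * ‖v‖ ^ 2 := by
  rw [norm_tangent, norm_sq_pairSpace]
  exact frobNorm_tangent_le _ _ _ _

theorem exists_norm_tangent_sq_eq (hm : 0 < m) (hn : 0 < n) (hr : 0 < r) (p : PairSpace m r n) :
    ∃ v : PairSpace m r n, ‖v‖ = 1 ∧
      ‖tangent p v‖ ^ 2 = specNorm (left p) ^ 2 + specNorm (right p) ^ 2 := by
  obtain ⟨H, K, h1, h2⟩ := exists_frobNorm_tangent_eq hm hn hr (left p) (right p)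
  refine ⟨pair H K, ?_, ?_⟩
  · rw [← sq_eq_sq₀ (norm_nonneg _) zero_le_one, norm_sq_pairSpace, left_pair, right_pair, h1,
      one_pow]
  · rw [norm_tangent, left_pair, right_pair, h2]

theorem exists_ne_zero_norm_tangent_sq_eq (hm : 0 < m) (hn : 0 < n) (hr : 0 < r)
    (p : PairSpace m r n) : ∃ v : PairSpace m r n, v ≠ 0 ∧
      ‖tangent p v‖ ^ 2 = (specNorm (left p) ^ 2 + specNorm (right p) ^ 2) * ‖v‖ ^ 2 := by
  obtain ⟨v, hv, h⟩ := exists_norm_tangent_sq_eq hm hn hr p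
  exact ⟨v, norm_ne_zero_iff.1 (by rw [hv]; exact one_ne_zero), by rw [h, hv]; ring⟩

theorem maxEigenvalue_hessian_objective (hm : 0 < m) (hn : 0 < n) (hr : 0 < r)
    {M : Matrix (Fin m) (Fin n) ℝ} {p : PairSpace m r n} (hp : p ∈ solutionSet r M) :
    maxEigenvalue (hessian (objective M) p) = specNorm (left p) ^ 2 + specNorm (right p) ^ 2 :=
  maxEigenvalue_gram (inner_hessian_objective hp) (norm_tangent_sq_le p)
    (exists_ne_zero_norm_tangent_sq_eq hm hn hr p)

theorem pair_mem_maxEigenspace_iff (hm : 0 < m) (hn : 0 < n) (hr : 0 < r)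
    {M : Matrix (Fin m) (Fin n) ℝ} {X H : Matrix (Fin m) (Fin r) ℝ}
    {Y K : Matrix (Fin r) (Fin n) ℝ} (hXY : X * Y = M) :
    pair H K ∈ maxEigenspace (hessian (objective M) (pair X Y)) ↔
      frobNorm (X * K + H * Y) ^ 2 =
        (specNorm X ^ 2 + specNorm Y ^ 2) * (frobNorm H ^ 2 + frobNorm K ^ 2) := by
  rw [mem_maxEigenspace_gram (inner_hessian_objective (p := pair X Y) hXY)
    (norm_tangent_sq_le _) (exists_ne_zero_norm_tangent_sq_eq hm hn hr _), norm_tangent,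
    norm_sq_pairSpace]
  rfl

end Eigenvalue

/-! ### Balanced factorizations -/

section Balanced

variable {m r n : ℕ}

/-- Lower bound for the largest eigenvalue over the whole solution set. -/
theorem two_mul_specNorm_mul_le (X : Matrix (Fin m) (Fin r) ℝ) (Y : Matrix (Fin r) (Fin n) ℝ) :
    2 * specNorm (X * Y) ≤ specNorm X ^ 2 + specNorm Y ^ 2 := by
  nlinarith [specNorm_mul_le X Y, sq_nonneg (specNorm X - specNorm Y)]

/-- If a nonzero matrix lies in the leading right singular spaces of both `X` and `Yᵀ`, then
the spectral norm of `X * Y` is as large as possible. -/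
theorem sq_le_specNorm_mul {k : ℕ} {X : Matrix (Fin m) (Fin r) ℝ} {Y : Matrix (Fin r) (Fin n) ℝ}
    {V : Matrix (Fin r) (Fin k) ℝ} {σ : ℝ} (hσ : 0 < σ) (hV : frobNorm V ≠ 0)
    (hX : frobNorm (X * V) = σ * frobNorm V) (hY : specNorm Y = σ)
    (hYV : frobNorm (Yᵀ * V) = σ * frobNorm V) : σ ^ 2 ≤ specNorm (X * Y) := by
  have h1 : Y * (Yᵀ * V) = σ ^ 2 • V := by
    have := transpose_mul_mul_eq Yᵀ V (by rw [specNorm_transpose, hY, hYV])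
    rwa [Matrix.transpose_transpose, specNorm_transpose, hY] at this
  -- Testing `X Y` on `Yᵀ V`: the image is `σ² X V`, of norm `σ³ ‖V‖`, while `‖Yᵀ V‖ = σ ‖V‖`.
  have h2 := frobNorm_mul_le_specNorm_mul (X * Y) (Yᵀ * V)
  rw [Matrix.mul_assoc, h1, Matrix.mul_smul, frobNorm_smul, hX, hYV,
    abs_of_nonneg (sq_nonneg σ)] at h2
  have h3 : 0 < σ * frobNorm V := mul_pos hσ ((frobNorm_nonneg V).lt_of_ne' hV)
  exact le_of_mul_le_mul_right h2 h3

theorem eq_sqrt_of_sq_le_specNorm_mul {X : Matrix (Fin m) (Fin r) ℝ}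
    {Y : Matrix (Fin r) (Fin n) ℝ} (hXY : specNorm X = specNorm Y)
    (h : specNorm Y ^ 2 ≤ specNorm (X * Y)) : specNorm Y = √(specNorm (X * Y)) := by
  have h2 := specNorm_mul_le X Y
  rw [hXY, ← sq] at h2
  rw [le_antisymm h2 h, Real.sqrt_sq (specNorm_nonneg _)]

/-- Since `‖X K + H Y‖² ≤ 2 ‖X K‖² + 2 ‖H Y‖² ≤ 2 σ² (‖H‖² + ‖K‖²)`, membership in the eigenspace
forces equality throughout. The columns of `K` are then leading for `X` and those of `Hᵀ` for `Yᵀ`;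
the relation `Hᵀ H = K Kᵀ` makes `Hᵀ` serve for both. -/
theorem eq_sqrt_of_mem_maxEigenspace {X H : Matrix (Fin m) (Fin r) ℝ}
    {Y K : Matrix (Fin r) (Fin n) ℝ} (hXY : specNorm X = specNorm Y) (hHK : (H, K) ≠ (0, 0))
    (h : frobNorm (X * K + H * Y) ^ 2 =
      (specNorm X ^ 2 + specNorm Y ^ 2) * (frobNorm H ^ 2 + frobNorm K ^ 2))
    (hb : Hᵀ * H = K * Kᵀ) : specNorm Y = √(specNorm (X * Y)) := by
  refine eq_sqrt_of_sq_le_specNorm_mul hXY ?_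
  rcases (specNorm_nonneg Y).eq_or_lt with h0 | h0
  · rw [← h0, sq, zero_mul]
    exact specNorm_nonneg _
  have hHK' : frobNorm H = frobNorm K := by
    rw [← sq_eq_sq₀ (frobNorm_nonneg _) (frobNorm_nonneg _), ← frobInner_self, frobInner, hb,
      ← frobNorm_transpose K, ← frobInner_self, frobInner, Matrix.transpose_transpose]
  have hK0 : frobNorm K ≠ 0 := fun hK => hHK <| by
    rw [frobNorm_eq_zero.1 hK, frobNorm_eq_zero.1 (hHK'.trans hK)]
  rw [hXY] at h
  set σ := specNorm Y with hσ
  have hXK : frobNorm (X * K) ≤ σ * frobNorm K := hXY ▸ frobNorm_mul_le_specNorm_mul X K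
  have hHY : frobNorm (H * Y) ≤ frobNorm H * σ := frobNorm_mul_le_mul_specNorm H Y
  have e1 := frobNorm_add_sq (X * K) (H * Y)
  have e2 := frobNorm_sub_sq (X * K) (H * Y)
  have i1 := pow_le_pow_left₀ (frobNorm_nonneg _) hXK 2
  have i2 := pow_le_pow_left₀ (frobNorm_nonneg _) hHY 2
  have i3 := sq_nonneg (frobNorm (X * K - H * Y))
  have hKe : frobNorm (X * K) = σ * frobNorm K := by
    rw [← sq_eq_sq₀ (frobNorm_nonneg _) (mul_nonneg h0.le (frobNorm_nonneg _))]
    nlinarith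
  have hHe : frobNorm (H * Y) = σ * frobNorm H := by
    rw [← sq_eq_sq₀ (frobNorm_nonneg _) (mul_nonneg h0.le (frobNorm_nonneg _))]
    nlinarith
  refine sq_le_specNorm_mul (V := Hᵀ) h0 (by rw [frobNorm_transpose, hHK']; exact hK0) ?_ rfl ?_
  -- `‖X Hᵀ‖ = ‖X K‖`, because both squares depend only on `Hᵀ H = K Kᵀ`.
  · rw [frobNorm_transpose, hHK', ← hKe,
      ← sq_eq_sq₀ (frobNorm_nonneg _) (frobNorm_nonneg _), ← frobInner_self, ← frobInner_self,
      frobInner_mul_right, frobInner_mul_right, Matrix.mul_assoc, Matrix.mul_assoc,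
      Matrix.transpose_transpose, hb]
  · rw [← Matrix.transpose_mul, frobNorm_transpose, frobNorm_transpose, hHe]

/-- A balanced factorization has compatible leading singular vectors. -/
theorem exists_singular_triple (hm : 0 < m) (hn : 0 < n) (hr : 0 < r)
    {X : Matrix (Fin m) (Fin r) ℝ} {Y : Matrix (Fin r) (Fin n) ℝ} {σ : ℝ}
    (hX : specNorm X = σ) (hY : specNorm Y = σ) (hM : specNorm (X * Y) = σ ^ 2) :
    ∃ (a : Matrix (Fin m) (Fin 1) ℝ) (v : Matrix (Fin r) (Fin 1) ℝ)
      (b : Matrix (Fin n) (Fin 1) ℝ), frobNorm a = 1 ∧ frobNorm v = 1 ∧ frobNorm b = 1 ∧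
        X * v = σ • a ∧ vᵀ * Y = σ • bᵀ := by
  rcases (hY ▸ specNorm_nonneg Y : 0 ≤ σ).eq_or_lt with h0 | h0
  · obtain ⟨a, ha⟩ := exists_frobNorm_eq_one hm
    obtain ⟨v, hv⟩ := exists_frobNorm_eq_one hr
    obtain ⟨b, hb⟩ := exists_frobNorm_eq_one hn
    refine ⟨a, v, b, ha, hv, hb, ?_, ?_⟩
    · rw [mul_eq_zero_of_specNorm_eq_zero (hX.trans h0.symm), ← h0, zero_smul]
    · rw [← Matrix.transpose_transpose Y, ← Matrix.transpose_mul, mul_eq_zero_of_specNorm_eq_zero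
        ((specNorm_transpose Y).trans (hY.trans h0.symm)), ← h0, zero_smul, Matrix.transpose_zero]
  -- For `b` leading for `X Y`, the chain `σ² = ‖X Y b‖ ≤ σ ‖Y b‖ ≤ σ²` is an equality, so `v = Y b
  -- / σ` is a unit vector leading for both `X` and `Yᵀ`.
  · obtain ⟨b, hb, hMb⟩ := exists_frobNorm_mul_eq hn (X * Y)
    rw [hM] at hMb
    have h1 : frobNorm (Y * b) ≤ σ := by
      simpa [hY, hb] using frobNorm_mul_le_specNorm_mul Y b
    have h2 : σ ^ 2 ≤ σ * frobNorm (Y * b) := by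
      rw [← hMb, Matrix.mul_assoc, ← hX]
      exact frobNorm_mul_le_specNorm_mul _ _
    have h3 : frobNorm (Y * b) = σ := le_antisymm h1 (by nlinarith)
    refine ⟨(σ ^ 2)⁻¹ • (X * Y * b), σ⁻¹ • (Y * b), b, frobNorm_smul_eq_one (by positivity) hMb,
      frobNorm_smul_eq_one h0 h3, hb, ?_, ?_⟩
    · rw [Matrix.mul_smul, smul_smul, Matrix.mul_assoc]
      congr 1
      field_simp
    · have h4 := transpose_mul_mul_eq Y b (by rw [h3, hY, hb, mul_one])
      rw [← Matrix.transpose_transpose Y, ← Matrix.transpose_mul, Matrix.transpose_transpose,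
        Matrix.mul_smul, h4, hY, smul_smul, ← Matrix.transpose_smul]
      congr 2
      field_simp

/-- With a common inner vector, take `H = a vᵀ` and `K = v bᵀ`. The last conclusion says that the
first-order and second-order terms of the product are aligned, which is used both for condition 4
and for the exact variation. -/
theorem exists_balanced_mem_maxEigenspace (hm : 0 < m) (hn : 0 < n) (hr : 0 < r)
    {X : Matrix (Fin m) (Fin r) ℝ} {Y : Matrix (Fin r) (Fin n) ℝ} {σ : ℝ}
    (hX : specNorm X = σ) (hY : specNorm Y = σ) (hM : specNorm (X * Y) = σ ^ 2) :
    ∃ (H : Matrix (Fin m) (Fin r) ℝ) (K : Matrix (Fin r) (Fin n) ℝ),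
      frobNorm H = 1 ∧ frobNorm K = 1 ∧ Hᵀ * H = K * Kᵀ ∧ frobNorm (H * K) = 1 ∧
      X * K + H * Y = (2 * σ) • (H * K) := by
  obtain ⟨a, v, b, ha, hv, hb, hXv, hvY⟩ := exists_singular_triple hm hn hr hX hY hM
  have hHK : a * vᵀ * (v * bᵀ) = a * bᵀ := by
    rw [Matrix.mul_assoc, ← Matrix.mul_assoc vᵀ, transpose_mul_self_eq_one hv, Matrix.one_mul]
  refine ⟨a * vᵀ, v * bᵀ, frobNorm_unit_mul_unit ha hv, frobNorm_unit_mul_unit hv hb, ?_, ?_, ?_⟩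
  · rw [Matrix.transpose_mul, Matrix.transpose_mul, Matrix.transpose_transpose,
      Matrix.transpose_transpose, Matrix.mul_assoc, ← Matrix.mul_assoc aᵀ,
      transpose_mul_self_eq_one ha, Matrix.mul_assoc v, ← Matrix.mul_assoc bᵀ,
      transpose_mul_self_eq_one hb]
  · rw [hHK, frobNorm_unit_mul_unit ha hb]
  · rw [hHK, ← Matrix.mul_assoc, hXv, Matrix.mul_assoc a, hvY, Matrix.smul_mul, Matrix.mul_smul,
      ← add_smul, two_mul]

end Balanced

end MatFac

namespace MatFac

/-! ### Variation of the objective around a solution -/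

section Variation

variable {m r n : ℕ} {M : Matrix (Fin m) (Fin n) ℝ}

theorem objective_eq_zero {p : PairSpace m r n} (hp : p ∈ solutionSet r M) :
    objective M p = 0 := by
  have : left p * right p = M := hp
  rw [objective, this, sub_self, frobNorm_eq_zero.2 rfl]
  norm_num

theorem mem_solutionSet_of_objective_eq_zero {p : PairSpace m r n} (h : objective M p = 0) :
    p ∈ solutionSet r M := by
  have : frobNorm (left p * right p - M) = 0 := by
    rw [objective] at h
    exact sq_eq_zero_iff.1 (by linarith)
  exact sub_eq_zero.1 (frobNorm_eq_zero.1 this)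

/-- The square root of the largest eigenvalue of the Hessian at a solution. -/
noncomputable def gain (p : PairSpace m r n) : ℝ :=
  √(specNorm (left p) ^ 2 + specNorm (right p) ^ 2)

theorem gain_nonneg (p : PairSpace m r n) : 0 ≤ gain p := Real.sqrt_nonneg _

theorem gain_sq (p : PairSpace m r n) :
    gain p ^ 2 = specNorm (left p) ^ 2 + specNorm (right p) ^ 2 := Real.sq_sqrt (by positivity)

theorem objective_add {p : PairSpace m r n} (hp : p ∈ solutionSet r M) (v : PairSpace m r n) :
    objective M (p + v) =
      frobNorm ((left p * right v + left v * right p) + left v * right v) ^ 2 / 2 := by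
  have : left p * right p = M := hp
  rw [objective, left_add, right_add, Matrix.add_mul, Matrix.mul_add, Matrix.mul_add, this]
  congr 3
  abel

theorem frobNorm_left_mul_right_le (v : PairSpace m r n) :
    frobNorm (left v * right v) ≤ ‖v‖ ^ 2 / 2 := by
  rw [norm_sq_pairSpace]
  nlinarith [frobNorm_mul_le (left v) (right v),
    sq_nonneg (frobNorm (left v) - frobNorm (right v))]

theorem norm_tangent_le (p v : PairSpace m r n) : ‖tangent p v‖ ≤ gain p * ‖v‖ := by
  rw [← sq_le_sq₀ (norm_nonneg _) (mul_nonneg (gain_nonneg p) (norm_nonneg v)), mul_pow, gain_sq]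
  exact norm_tangent_sq_le p v

theorem variation_objective_le {p : PairSpace m r n} (hp : p ∈ solutionSet r M) (ρ : ℝ) :
    variation (objective M) p ρ ≤ ENNReal.ofReal ((gain p * ρ + ρ ^ 2 / 2) ^ 2 / 2) := by
  refine iSup₂_le fun y hy => ENNReal.ofReal_le_ofReal ?_
  obtain ⟨v, rfl⟩ : ∃ v, y = p + v := ⟨y - p, by abel⟩
  have hv : ‖v‖ ≤ ρ := by simpa [dist_eq_norm] using hy
  have hv0 := norm_nonneg v
  rw [objective_eq_zero hp, sub_zero, objective_add hp, abs_of_nonneg (by positivity)]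
  have h1 := frobNorm_add_le (left p * right v + left v * right p) (left v * right v)
  rw [← norm_tangent] at h1
  have h2 := frobNorm_left_mul_right_le v
  have h3 := norm_tangent_le p v
  have h4 : gain p * ‖v‖ ≤ gain p * ρ := mul_le_mul_of_nonneg_left hv (gain_nonneg p)
  have h5 : ‖v‖ ^ 2 ≤ ρ ^ 2 := pow_le_pow_left₀ hv0 hv 2
  gcongr
  · exact frobNorm_nonneg _
  · linarith

theorem le_variation_objective_of_norm_le {p v : PairSpace m r n} (hp : p ∈ solutionSet r M)
    {ρ c : ℝ} (hv : ‖v‖ ≤ ρ) (hc : 0 ≤ c)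
    (h : c ≤ frobNorm ((left p * right v + left v * right p) + left v * right v)) :
    ENNReal.ofReal (c ^ 2 / 2) ≤ variation (objective M) p ρ := by
  refine le_trans ?_ (le_iSup₂_of_le (p + v) (by simpa [dist_eq_norm] using hv) le_rfl)
  rw [objective_eq_zero hp, sub_zero, objective_add hp, abs_of_nonneg (by positivity)]
  exact ENNReal.ofReal_le_ofReal (by gcongr)

theorem le_variation_objective (hm : 0 < m) (hn : 0 < n) (hr : 0 < r) {p : PairSpace m r n}
    (hp : p ∈ solutionSet r M) {ρ : ℝ} (hρ : 0 ≤ ρ) (h : ρ ≤ gain p) :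
    ENNReal.ofReal ((gain p * ρ - ρ ^ 2 / 2) ^ 2 / 2) ≤ variation (objective M) p ρ := by
  obtain ⟨v, hv, hL⟩ := exists_norm_tangent_sq_eq hm hn hr p
  rw [← gain_sq, sq_eq_sq₀ (norm_nonneg _) (gain_nonneg p)] at hL
  have hv' : ‖ρ • v‖ = ρ := by rw [norm_smul, hv, mul_one, Real.norm_eq_abs, abs_of_nonneg hρ]
  refine le_variation_objective_of_norm_le hp hv'.le (by nlinarith) ?_
  have h1 : ‖tangent p (ρ • v)‖ = gain p * ρ := by
    rw [map_smul, norm_smul, hL, Real.norm_eq_abs, abs_of_nonneg hρ, mul_comm]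
  have h2 := frobNorm_left_mul_right_le (ρ • v)
  have h3 := frobNorm_add_le ((left p * right (ρ • v) + left (ρ • v) * right p) +
    left (ρ • v) * right (ρ • v)) ((-1 : ℝ) • (left (ρ • v) * right (ρ • v)))
  have h4 : left p * right (ρ • v) + left (ρ • v) * right p + left (ρ • v) * right (ρ • v) +
      (-1 : ℝ) • (left (ρ • v) * right (ρ • v)) =
      left p * right (ρ • v) + left (ρ • v) * right p := by
    rw [neg_one_smul, add_neg_cancel_right]
  rw [h4, ← norm_tangent, h1, frobNorm_smul] at h3
  rw [hv'] at h2
  norm_num at h3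
  linarith

/-- Along the balanced direction both terms of the increment are nonnegative multiples of `H K`, so
their norms add up and match `variation_objective_le`. -/
theorem le_variation_objective_of_balanced (hm : 0 < m) (hn : 0 < n) (hr : 0 < r)
    {p : PairSpace m r n} (hp : p ∈ solutionSet r M) {σ : ℝ} (hX : specNorm (left p) = σ)
    (hY : specNorm (right p) = σ) (hM : specNorm M = σ ^ 2) {ρ : ℝ} (hρ : 0 ≤ ρ) :
    ENNReal.ofReal ((gain p * ρ + ρ ^ 2 / 2) ^ 2 / 2) ≤ variation (objective M) p ρ := by
  have hp' : left p * right p = M := hp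
  obtain ⟨H, K, hH, hK, -, hHK, hL⟩ :=
    exists_balanced_mem_maxEigenspace hm hn hr hX hY (by rw [hp', hM])
  have hσ : 0 ≤ σ := hX ▸ specNorm_nonneg _
  have h2 : √2 ^ 2 = (2 : ℝ) := Real.sq_sqrt zero_le_two
  have h20 : (0 : ℝ) < √2 := by positivity
  have hg : gain p = √2 * σ := by
    rw [← sq_eq_sq₀ (gain_nonneg p) (by positivity), gain_sq, hX, hY, mul_pow, h2]
    ring
  have hg0 := gain_nonneg p
  -- The pair `(H, K)` has norm `√2`, so this vector has norm `ρ`.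
  refine le_variation_objective_of_norm_le (v := (ρ / √2) • pair H K) hp ?_ (by positivity)
    (le_of_eq ?_)
  · rw [← sq_le_sq₀ (norm_nonneg _) hρ, norm_smul, mul_pow, norm_sq_pairSpace, left_pair,
      right_pair, hH, hK, Real.norm_eq_abs, sq_abs, div_pow, h2]
    linarith
  · have : left p * right ((ρ / √2) • pair H K) + left ((ρ / √2) • pair H K) * right p +
        left ((ρ / √2) • pair H K) * right ((ρ / √2) • pair H K) =
        (ρ / √2 * (2 * σ) + (ρ / √2) ^ 2) • (H * K) := by
      rw [left_smul, right_smul, left_pair, right_pair, Matrix.mul_smul, Matrix.smul_mul,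
        Matrix.mul_smul, Matrix.smul_mul, ← smul_add, hL, smul_smul, smul_smul, ← add_smul, sq]
    rw [this, frobNorm_smul, hHK, mul_one, abs_of_nonneg (by positivity), hg, div_pow, h2]
    field_simp
    linear_combination ρ * σ * h2 * 2

theorem exists_variation_lt (hm : 0 < m) (hn : 0 < n) (hr : 0 < r) {p q : PairSpace m r n}
    (hp : p ∈ solutionSet r M) (hq : q ∈ solutionSet r M) (h : gain p < gain q) :
    ∃ R, 0 < R ∧ ∀ ρ ∈ Set.Ioc 0 R,
      variation (objective M) p ρ < variation (objective M) q ρ := by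
  have hp0 := gain_nonneg p
  -- The two bounds separate as soon as `ρ < gain q - gain p`; half of that also ensures `ρ ≤ gain
  -- q`.
  refine ⟨(gain q - gain p) / 2, by linarith, fun ρ ⟨h0, hρ⟩ => ?_⟩
  refine ((variation_objective_le hp ρ).trans_lt ?_).trans_le
    (le_variation_objective hm hn hr hq h0.le (by linarith))
  have h1 : gain p * ρ + ρ ^ 2 / 2 < gain q * ρ - ρ ^ 2 / 2 := by nlinarith
  have h2 : (gain p * ρ + ρ ^ 2 / 2) ^ 2 < (gain q * ρ - ρ ^ 2 / 2) ^ 2 :=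
    pow_lt_pow_left₀ h1 (by positivity) two_ne_zero
  exact (ENNReal.ofReal_lt_ofReal_iff_of_nonneg (by positivity)).2 (by linarith)

theorem isGloballyFlat_of_balanced (hm : 0 < m) (hn : 0 < n) (hr : 0 < r)
    {p : PairSpace m r n} (hp : p ∈ solutionSet r M) {σ : ℝ} (hX : specNorm (left p) = σ)
    (hY : specNorm (right p) = σ) (hM : specNorm M = σ ^ 2) :
    IsGloballyFlat (objective M) p := by
  intro q hq
  have hq : q ∈ solutionSet r M :=
    mem_solutionSet_of_objective_eq_zero (Eq.trans hq (objective_eq_zero hp))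
  have hq' : left q * right q = M := hq
  rcases lt_or_ge (gain p) (gain q) with h | h
  · obtain ⟨R, hR, hlt⟩ := exists_variation_lt hm hn hr hp hq h
    exact ⟨R, hR, fun ρ hρ => (hlt ρ hρ).le⟩
  -- Here `‖X'‖₂² + ‖Y'‖₂² ≤ 2 σ² ≤ 2 ‖X'‖₂ ‖Y'‖₂` for the factors of `q`, so `q` is balanced with
  -- the same `σ`, and its variation equals the upper bound for `p`.
  · have h1 := pow_le_pow_left₀ (gain_nonneg q) h 2
    rw [gain_sq, gain_sq, hX, hY] at h1
    have hσ : 0 ≤ σ := hX ▸ specNorm_nonneg _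
    have h2 := specNorm_mul_le (left q) (right q)
    rw [hq', hM] at h2
    have h3 : specNorm (left q) = specNorm (right q) := by
      rw [← sub_eq_zero, ← sq_eq_zero_iff]
      exact le_antisymm (by nlinarith) (sq_nonneg _)
    have h4 : specNorm (left q) = σ := by
      rw [← sq_eq_sq₀ (specNorm_nonneg _) hσ]
      rw [← h3] at h1 h2
      nlinarith
    have hgain : gain p = gain q := by rw [gain, gain, hX, hY, ← h3, h4]
    refine ⟨1, one_pos, fun ρ hρ => (variation_objective_le hp ρ).trans ?_⟩
    rw [hgain]
    exact le_variation_objective_of_balanced hm hn hr hq h4 (h3 ▸ h4) hM hρ.1.le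

theorem mem_argLocMin_of_isFlat (hm : 0 < m) (hn : 0 < n) (hr : 0 < r) {p : PairSpace m r n}
    (hp : p ∈ solutionSet r M) (h : IsFlat (objective M) p) :
    p ∈ argLocMin (fun q => maxEigenvalue (hessian (objective M) q)) (solutionSet r M) := by
  obtain ⟨U, hU, hflat⟩ := h
  refine ⟨hp, ?_⟩
  filter_upwards [mem_nhdsWithin_of_mem_nhds hU, self_mem_nhdsWithin] with q hqU hq
  rw [maxEigenvalue_hessian_objective hm hn hr hp, maxEigenvalue_hessian_objective hm hn hr hq]
  by_contra! hlt
  have hlt' : gain q < gain p := Real.sqrt_lt_sqrt (by positivity) hlt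
  obtain ⟨R, hR, h1⟩ := exists_variation_lt hm hn hr hq hp hlt'
  obtain ⟨R', hR', h2⟩ := hflat q ⟨⟨hqU, (objective_eq_zero hq).trans (objective_eq_zero hp).symm⟩,
    fun h => hlt'.ne (by rw [Set.mem_singleton_iff.1 h])⟩
  have hmin : 0 < min R R' := lt_min hR hR'
  exact (h1 _ ⟨hmin, min_le_left _ _⟩).not_ge (h2 _ ⟨hmin, min_le_right _ _⟩)

end Variation

end MatFac

namespace MatFac

/-! ### Local minimizers of the largest eigenvalue are balanced -/

section Descent

open Filter Topology

variable {m r n : ℕ}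

theorem continuousAt_mul {T : Type*} [TopologicalSpace T] {x : T}
    {f : T → Matrix (Fin m) (Fin r) ℝ} {g : T → Matrix (Fin r) (Fin n) ℝ}
    (hf : ContinuousAt f x) (hg : ContinuousAt g x) : ContinuousAt (fun z => f z * g z) x :=
  ContinuousAt.comp (g := fun z : Matrix (Fin m) (Fin r) ℝ × Matrix (Fin r) (Fin n) ℝ => z.1 * z.2)
    (continuous_fst.matrix_mul continuous_snd).continuousAt (hf.prodMk hg)

theorem continuousAt_frobInner {T : Type*} [TopologicalSpace T] {x : T}
    {f g : T → Matrix (Fin m) (Fin n) ℝ} (hf : ContinuousAt f x) (hg : ContinuousAt g x) :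
    ContinuousAt (fun z => frobInner (f z) (g z)) x := by
  simp only [frobInner_eq_sum]
  exact tendsto_finsetSum _ fun i _ => tendsto_finsetSum _ fun j _ =>
    (((continuous_apply_apply i j).continuousAt).comp hf).mul
      (((continuous_apply_apply i j).continuousAt).comp hg)

theorem continuous_column : Continuous (column : EuclideanSpace ℝ (Fin n) → _) := by
  unfold column
  fun_prop

/-- First-order decrease of the spectral norm, when the squared norm decreases to first order
along all the leading right singular vectors. -/
theorem eventually_specNorm_mul_lt (hn : 0 < n) (A : Matrix (Fin m) (Fin n) ℝ)
    (Z : ℝ → Matrix (Fin n) (Fin n) ℝ) (hZ : ContinuousAt Z 0)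
    (h : ∀ v : Matrix (Fin n) (Fin 1) ℝ, frobNorm v = 1 → frobNorm (A * v) = specNorm A →
      frobInner (A * v) (A * (Z 0 * v)) < 0) :
    ∀ᶠ t in 𝓝[>] 0, specNorm (A * (1 + t • Z t)) < specNorm A := by
  have hle : ∀ v ∈ Metric.sphere (0 : EuclideanSpace ℝ (Fin n)) 1,
      frobNorm (A * column v) ≤ specNorm A := fun v hv => by
    have hv : ‖v‖ = 1 := by simpa using hv
    simpa [hv] using frobNorm_mul_column_le A v
  have hcol : ∀ v : EuclideanSpace ℝ (Fin n),
      ContinuousAt (fun z : ℝ × EuclideanSpace ℝ (Fin n) => column z.2) (0, v) := fun v =>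
    (continuous_column.comp continuous_snd).continuousAt
  have hZ' : ∀ v : EuclideanSpace ℝ (Fin n),
      ContinuousAt (fun z : ℝ × EuclideanSpace ℝ (Fin n) => Z z.1) (0, v) := fun v =>
    ContinuousAt.comp (f := Prod.fst) (x := ((0 : ℝ), v)) hZ continuousAt_fst
  have hmulZ : ∀ v : EuclideanSpace ℝ (Fin n), ContinuousAt
      (fun z : ℝ × EuclideanSpace ℝ (Fin n) => A * (Z z.1 * column z.2)) (0, v) := fun v =>
    continuousAt_mul continuousAt_const (continuousAt_mul (hZ' v) (hcol v))
  have hmul : ∀ v : EuclideanSpace ℝ (Fin n), ContinuousAt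
      (fun z : ℝ × EuclideanSpace ℝ (Fin n) => A * column z.2) (0, v) := fun v =>
    continuousAt_mul continuousAt_const (hcol v)
  have hexp : ∀ (t : ℝ) (v : EuclideanSpace ℝ (Fin n)),
      A * (1 + t • Z t) * column v = A * column v + t • (A * (Z t * column v)) := fun t v => by
    rw [Matrix.mul_add, Matrix.add_mul, Matrix.mul_one, Matrix.mul_smul, Matrix.smul_mul,
      Matrix.mul_assoc]
  -- Compactness of the sphere turns local decrease near each `(0, v)` into decrease uniform in `v`.
  -- The neighbourhoods are taken in the full product, hence the premises `v ∈ sphere` and `0 < t`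
  -- inside `P`.
  have hev := (isCompact_sphere (0 : EuclideanSpace ℝ (Fin n)) 1).eventually_forall_of_forall_eventually
    (x₀ := (0 : ℝ)) (P := fun t v => v ∈ Metric.sphere (0 : EuclideanSpace ℝ (Fin n)) 1 → 0 < t →
      frobNorm (A * (1 + t • Z t) * column v) ^ 2 < specNorm A ^ 2) (fun v hv => by
    have hv1 : ‖v‖ = 1 := by simpa using hv
    rcases (hle v hv).eq_or_lt with he | hlt
    -- At a leading `v`, the squared norm is `‖A w‖²` plus `t` times this function at nearby `(t,
    -- w)`. It is negative at `(0, v)`, hence nearby, and `‖A w‖ ≤ ‖A‖₂` even if `w` is not leading.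
    · have hcont : ContinuousAt (fun z : ℝ × EuclideanSpace ℝ (Fin n) =>
          2 * frobInner (A * column z.2) (A * (Z z.1 * column z.2)) +
            z.1 * frobInner (A * (Z z.1 * column z.2)) (A * (Z z.1 * column z.2))) (0, v) :=
        (continuousAt_const.mul (continuousAt_frobInner (hmul v) (hmulZ v))).add
          (continuousAt_fst.mul (continuousAt_frobInner (hmulZ v) (hmulZ v)))
      have hneg := h (column v) (by rw [frobNorm_column, hv1]) he
      filter_upwards [hcont.eventually_lt continuousAt_const
        (by rw [zero_mul, add_zero]; linarith)] with z hz hz2 hz1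
      have h1 := pow_le_pow_left₀ (frobNorm_nonneg _) (hle _ hz2) 2
      rw [frobInner_self] at hz
      rw [hexp, frobNorm_add_sq, frobInner_smul_right, frobNorm_smul, mul_pow, sq_abs]
      nlinarith
    -- At a non-leading `v` the inequality is already strict at `t = 0`, and continuity suffices.
    · have hcont : ContinuousAt (fun z : ℝ × EuclideanSpace ℝ (Fin n) =>
          frobInner (A * column z.2 + z.1 • (A * (Z z.1 * column z.2)))
            (A * column z.2 + z.1 • (A * (Z z.1 * column z.2)))) (0, v) := by
        have := (hmul v).add (continuousAt_fst.smul (hmulZ v))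
        exact continuousAt_frobInner this this
      have h1 := pow_lt_pow_left₀ hlt (frobNorm_nonneg _) two_ne_zero
      filter_upwards [hcont.eventually_lt continuousAt_const
        (by simpa only [zero_smul, add_zero, frobInner_self] using h1)] with z hz _ _
      rw [hexp, ← frobInner_self]
      exact hz)
  filter_upwards [mem_nhdsWithin_of_mem_nhds hev, self_mem_nhdsWithin] with t ht ht0
  obtain ⟨v, hv, hA⟩ := exists_frobNorm_mul_column_eq hn (A * (1 + t • Z t))
  have hv' : v ∈ Metric.sphere (0 : EuclideanSpace ℝ (Fin n)) 1 := by simpa using hv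
  rw [← hA]
  exact lt_of_pow_lt_pow_left₀ 2 (specNorm_nonneg A) (ht v hv' hv' ht0)

theorem continuous_pair : Continuous fun z : Matrix (Fin m) (Fin r) ℝ ×
    Matrix (Fin r) (Fin n) ℝ => pair z.1 z.2 := by
  refine (PiLp.continuous_toLp 2 _).comp (continuous_pi fun i => ?_)
  rcases i with i | i <;> simp only [Sum.elim_inl, Sum.elim_inr] <;> fun_prop

/-- The sum of the squared spectral norms of the two factors. -/
noncomputable def specSum (p : PairSpace m r n) : ℝ :=
  specNorm (left p) ^ 2 + specNorm (right p) ^ 2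

variable {M : Matrix (Fin m) (Fin n) ℝ} {X : Matrix (Fin m) (Fin r) ℝ}
  {Y : Matrix (Fin r) (Fin n) ℝ}

/-- The curve `(s X, s⁻¹ Y)` stays in the solution set, and the derivative of `specSum` along it at
`s = 1` is `2 ‖X‖₂² - 2 ‖Y‖₂²`. -/
theorem specNorm_eq_of_isLocalMinOn (hXY : X * Y = M)
    (h : IsLocalMinOn specSum (solutionSet r M) (pair X Y)) : specNorm X = specNorm Y := by
  have hcont : ContinuousAt (fun s : ℝ => pair (s • X) (s⁻¹ • Y)) 1 :=
    continuous_pair.continuousAt.comp (ContinuousAt.prodMk (by fun_prop)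
      ((continuousAt_inv₀ one_ne_zero).smul continuousAt_const))
  have hmem : ∀ᶠ s : ℝ in 𝓝 1, pair (s • X) (s⁻¹ • Y) ∈ solutionSet r M := by
    filter_upwards [lt_mem_nhds zero_lt_one] with s hs
    change s • X * s⁻¹ • Y = M
    rw [Matrix.smul_mul, Matrix.mul_smul, smul_inv_smul₀ hs.ne', hXY]
  have hlim : Tendsto (fun s : ℝ => pair (s • X) (s⁻¹ • Y)) (𝓝 1)
      (𝓝[solutionSet r M] (pair X Y)) := by
    refine tendsto_nhdsWithin_iff.2 ⟨?_, hmem⟩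
    simpa [ContinuousAt] using hcont
  have hval : ∀ s : ℝ, specSum (pair (s • X) (s⁻¹ • Y)) =
      s ^ 2 * specNorm X ^ 2 + (s⁻¹) ^ 2 * specNorm Y ^ 2 := fun s => by
    rw [specSum, left_pair, right_pair, specNorm_smul, specNorm_smul, mul_pow, mul_pow, sq_abs,
      sq_abs]
  have hmin : IsLocalMin (fun s : ℝ => s ^ 2 * specNorm X ^ 2 + (s⁻¹) ^ 2 * specNorm Y ^ 2) 1 := by
    filter_upwards [hlim.eventually h] with s hs
    rw [hval] at hs
    simpa [specSum] using hs
  have hd : HasDerivAt (fun s : ℝ => s ^ 2 * specNorm X ^ 2 + (s⁻¹) ^ 2 * specNorm Y ^ 2)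
      (2 * specNorm X ^ 2 - 2 * specNorm Y ^ 2) 1 := by
    have h1 := ((hasDerivAt_id (1 : ℝ)).pow 2).mul_const (specNorm X ^ 2)
    have h2 := ((hasDerivAt_inv (one_ne_zero (α := ℝ))).pow 2).mul_const (specNorm Y ^ 2)
    refine (h1.add h2).congr_deriv ?_
    simp
    ring
  have := hmin.hasDerivAt_eq_zero hd
  rw [← sq_eq_sq₀ (specNorm_nonneg _) (specNorm_nonneg _)]
  linarith

/-- As `AᵀA v = σ² v`, the left side is `σ² (‖Bᵀ v‖² - σ²)`. It vanishes only if `v` is leading for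
`Bᵀ` too, which `sq_le_specNorm_mul` excludes. -/
theorem frobInner_balancing_lt (A : Matrix (Fin m) (Fin r) ℝ) (B : Matrix (Fin r) (Fin n) ℝ)
    {σ : ℝ} (hσ : 0 < σ) (hA : specNorm A = σ) (hB : specNorm B = σ)
    (hAB : specNorm (A * B) < σ ^ 2) (v : Matrix (Fin r) (Fin 1) ℝ) (hv : frobNorm v = 1)
    (hAv : frobNorm (A * v) = σ) :
    frobInner (A * v) (A * ((B * Bᵀ - Aᵀ * A) * v)) < 0 := by
  have h1 : Aᵀ * (A * v) = σ ^ 2 • v := by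
    have := transpose_mul_mul_eq A v (by rw [hA, hAv, hv, mul_one])
    rwa [hA] at this
  have h2 : frobNorm (Bᵀ * v) ≤ σ := by
    have := frobNorm_mul_le_specNorm_mul Bᵀ v
    rwa [specNorm_transpose, hB, hv, mul_one] at this
  have h3 : frobNorm (Bᵀ * v) ≠ σ := fun h3 => hAB.not_ge <|
    sq_le_specNorm_mul hσ (by rw [hv]; exact one_ne_zero) (by rw [hAv, hv, mul_one]) hB
      (by rw [h3, hv, mul_one])
  have h4 := pow_lt_pow_left₀ (h2.lt_of_ne h3) (frobNorm_nonneg _) two_ne_zero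
  have h5 : frobInner v (B * (Bᵀ * v)) = frobNorm (Bᵀ * v) ^ 2 := by
    rw [frobInner_comm, frobInner_mul_left, frobInner_self]
  rw [frobInner_comm, frobInner_mul_left, h1, frobInner_smul_right, Matrix.sub_mul,
    Matrix.mul_assoc, Matrix.mul_assoc, h1, frobInner_sub_left, frobInner_comm _ v, h5,
    frobInner_smul_left, frobInner_self, hv]
  have : 0 < σ ^ 2 := by positivity
  nlinarith

theorem sq_le_specNorm_of_isLocalMinOn (hr : 0 < r) (hXY : X * Y = M) {σ : ℝ}
    (hX : specNorm X = σ) (hY : specNorm Y = σ)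
    (h : IsLocalMinOn specSum (solutionSet r M) (pair X Y)) : σ ^ 2 ≤ specNorm M := by
  by_contra! hlt
  have hσ : 0 < σ := by
    refine (hX ▸ specNorm_nonneg X : 0 ≤ σ).lt_of_ne fun h0 => ?_
    rw [← h0] at hlt
    norm_num at hlt
    exact hlt.not_ge (specNorm_nonneg M)
  set Z : Matrix (Fin r) (Fin r) ℝ := Y * Yᵀ - Xᵀ * X with hZ
  have hZt : Zᵀ = Z := by simp [hZ]
  set G : ℝ → Matrix (Fin r) (Fin r) ℝ := fun t => 1 + t • Z with hG
  have hGcont : Continuous G := by fun_prop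
  have hG0 : G 0 = 1 := by simp [hG]
  have hinv : ContinuousAt (fun t => (G t)⁻¹) 0 := by
    refine ContinuousAt.comp (g := Inv.inv) (continuousAt_matrix_inv _ ?_) hGcont.continuousAt
    rw [Ring.inverse_eq_inv', hG0, Matrix.det_one]
    exact continuousAt_inv₀ one_ne_zero
  have hunit : ∀ᶠ t in 𝓝 0, IsUnit (G t).det := by
    have : ContinuousAt (fun t => (G t).det) 0 := hGcont.matrix_det.continuousAt
    filter_upwards [this.eventually_ne (by rw [hG0, Matrix.det_one]; exact one_ne_zero)]
      with t ht using ht.isUnit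
  -- From `G⁻¹ = 1 - t Z G⁻¹`, the transpose of `G⁻¹ Y` is `Yᵀ (1 + t W t)`. This direction varies
  -- with `t`, unlike the one for `X`.
  set W : ℝ → Matrix (Fin r) (Fin r) ℝ := fun t => (-(Z * (G t)⁻¹))ᵀ with hW
  have hWcont : ContinuousAt W 0 :=
    continuous_id.matrix_transpose.continuousAt.comp (continuousAt_mul continuousAt_const hinv).neg
  have hW0 : W 0 = Xᵀ * X - Y * Yᵀ := by
    rw [hW]
    simp only [hG0, inv_one, Matrix.mul_one, Matrix.transpose_neg, hZt]
    rw [hZ, neg_sub]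
  have evX : ∀ᶠ t in 𝓝[>] 0, specNorm (X * G t) < specNorm X := by
    refine eventually_specNorm_mul_lt hr X (fun _ => Z) continuousAt_const fun v hv hXv => ?_
    exact frobInner_balancing_lt X Y hσ hX hY (by rwa [hXY]) v hv (hXv.trans hX)
  have evY : ∀ᶠ t in 𝓝[>] 0, specNorm (Yᵀ * (1 + t • W t)) < specNorm Yᵀ := by
    refine eventually_specNorm_mul_lt hr Yᵀ W hWcont fun v hv hYv => ?_
    -- `W 0 = -Z` is the balancing direction of the transposed pair `(Yᵀ, Xᵀ)`, so one curve
    -- improves both factors.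
    have := frobInner_balancing_lt Yᵀ Xᵀ hσ ((specNorm_transpose Y).trans hY)
      ((specNorm_transpose X).trans hX)
      (by rwa [← Matrix.transpose_mul, specNorm_transpose, hXY]) v hv
      (hYv.trans ((specNorm_transpose Y).trans hY))
    rwa [Matrix.transpose_transpose, Matrix.transpose_transpose, ← hW0] at this
  have hWG : ∀ t, IsUnit (G t).det → Yᵀ * (1 + t • W t) = ((G t)⁻¹ * Y)ᵀ := fun t ht => by
    have h1 : (1 + t • Z) * (G t)⁻¹ = 1 := Matrix.mul_nonsing_inv _ ht
    have h2 : (G t)⁻¹ = 1 + t • -(Z * (G t)⁻¹) := by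
      rw [Matrix.add_mul, Matrix.one_mul, Matrix.smul_mul] at h1
      rw [smul_neg, ← sub_eq_add_neg, eq_sub_iff_add_eq, h1]
    rw [Matrix.transpose_mul]
    congr 1
    conv_rhs => rw [h2]
    simp [hW]
  have hlim : Tendsto (fun t => pair (X * G t) ((G t)⁻¹ * Y)) (𝓝[>] 0)
      (𝓝[solutionSet r M] (pair X Y)) := by
    refine tendsto_nhdsWithin_iff.2 ⟨?_, ?_⟩
    · have : ContinuousAt (fun t => pair (X * G t) ((G t)⁻¹ * Y)) 0 :=
        continuous_pair.continuousAt.comp ((continuousAt_mul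
          continuousAt_const hGcont.continuousAt).prodMk (continuousAt_mul hinv continuousAt_const))
      simpa [ContinuousAt, hG0] using this.mono_left nhdsWithin_le_nhds
    · filter_upwards [mem_nhdsWithin_of_mem_nhds hunit] with t ht
      change X * G t * ((G t)⁻¹ * Y) = M
      rw [Matrix.mul_assoc, Matrix.mul_nonsing_inv_cancel_left _ _ ht, hXY]
  obtain ⟨t, ht, htX, htY, hmin⟩ := ((hunit.filter_mono nhdsWithin_le_nhds).and
    (evX.and (evY.and (hlim.eventually h)))).exists
  rw [hWG t ht, specNorm_transpose, specNorm_transpose] at htY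
  rw [specSum, specSum, left_pair, left_pair, right_pair, right_pair] at hmin
  have h1 := pow_lt_pow_left₀ htX (specNorm_nonneg _) two_ne_zero
  have h2 := pow_lt_pow_left₀ htY (specNorm_nonneg _) two_ne_zero
  linarith

end Descent

end MatFac

theorem proposition3p17 (m n r : ℕ) (hm : 0 < m) (hn : 0 < n) (hr : 0 < r)
    (M : Matrix (Fin m) (Fin n) ℝ)
    (X : Matrix (Fin m) (Fin r) ℝ) (Y : Matrix (Fin r) (Fin n) ℝ) (hXY : X * Y = M) :
    List.TFAE [
      MatFac.IsGloballyFlat (MatFac.objective M) (MatFac.pair X Y),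
      MatFac.IsFlat (MatFac.objective M) (MatFac.pair X Y),
      MatFac.pair X Y ∈ MatFac.argLocMin
        (fun p => MatFac.maxEigenvalue (MatFac.hessian (MatFac.objective M) p))
        (MatFac.solutionSet r M),
      MatFac.specNorm X = MatFac.specNorm Y ∧
        ∃ (H : Matrix (Fin m) (Fin r) ℝ) (K : Matrix (Fin r) (Fin n) ℝ),
          MatFac.pair H K ∈ MatFac.maxEigenspace
            (MatFac.hessian (MatFac.objective M) (MatFac.pair X Y)) ∧
          (H, K) ≠ (0, 0) ∧ Hᵀ * H = K * Kᵀ,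
      MatFac.pair X Y ∈ MatFac.argMin
        (fun p => MatFac.maxEigenvalue (MatFac.hessian (MatFac.objective M) p))
        (MatFac.solutionSet r M),
      MatFac.specNorm X = MatFac.specNorm Y ∧
        MatFac.specNorm Y = √(MatFac.specNorm M)] := by
  have hmem : MatFac.pair X Y ∈ MatFac.solutionSet r M := hXY
  tfae_have 1 → 2 := fun h => ⟨Set.univ, Filter.univ_mem, fun y hy => h y hy.1.2⟩
  tfae_have 2 → 3 := MatFac.mem_argLocMin_of_isFlat hm hn hr hmem
  tfae_have 3 → 6 := by
    rintro ⟨-, h⟩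
    have hloc : IsLocalMinOn MatFac.specSum (MatFac.solutionSet r M) (MatFac.pair X Y) := by
      filter_upwards [h, self_mem_nhdsWithin] with q hq hqM
      rwa [MatFac.maxEigenvalue_hessian_objective hm hn hr hmem,
        MatFac.maxEigenvalue_hessian_objective hm hn hr hqM] at hq
    have heq := MatFac.specNorm_eq_of_isLocalMinOn hXY hloc
    refine ⟨heq, ?_⟩
    have := MatFac.sq_le_specNorm_of_isLocalMinOn hr hXY heq rfl hloc
    rw [← hXY] at this ⊢
    exact MatFac.eq_sqrt_of_sq_le_specNorm_mul heq this
  tfae_have 4 → 6 := by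
    rintro ⟨heq, H, K, hE, h0, hb⟩
    rw [MatFac.pair_mem_maxEigenspace_iff hm hn hr hXY] at hE
    rw [← hXY]
    exact ⟨heq, MatFac.eq_sqrt_of_mem_maxEigenspace heq h0 hE hb⟩
  tfae_have 5 → 3 := fun ⟨h1, h2⟩ => ⟨h1, h2.localize⟩
  tfae_have 6 → 5 := by
    rintro ⟨hX, hY⟩
    refine ⟨hmem, fun q hq => ?_⟩
    change MatFac.maxEigenvalue _ ≤ MatFac.maxEigenvalue _
    have hq' : MatFac.left q * MatFac.right q = M := hq
    rw [MatFac.maxEigenvalue_hessian_objective hm hn hr hmem,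
      MatFac.maxEigenvalue_hessian_objective hm hn hr hq, MatFac.left_pair, MatFac.right_pair, hX,
      hY, Real.sq_sqrt (MatFac.specNorm_nonneg M), ← two_mul, ← hq']
    exact MatFac.two_mul_specNorm_mul_le _ _
  have hsq : MatFac.specNorm Y = √(MatFac.specNorm M) →
      MatFac.specNorm M = MatFac.specNorm Y ^ 2 := fun h => by
    rw [h, Real.sq_sqrt (MatFac.specNorm_nonneg M)]
  tfae_have 6 → 4 := by
    rintro ⟨hX, hY⟩
    obtain ⟨H, K, hH, hK, hb, hHK, hL⟩ := MatFac.exists_balanced_mem_maxEigenspace hm hn hr hX rfl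
      (by rw [hXY, hsq hY])
    refine ⟨hX, H, K, ?_, fun h0 => ?_, hb⟩
    · rw [MatFac.pair_mem_maxEigenspace_iff hm hn hr hXY, hL, MatFac.frobNorm_smul, hHK, hH, hK,
        hX, mul_one, sq_abs]
      ring
    · obtain ⟨rfl, -⟩ := Prod.mk.inj h0
      rw [MatFac.frobNorm_eq_zero.2 rfl] at hH
      exact zero_ne_one hH
  tfae_have 6 → 1 := fun ⟨hX, hY⟩ => MatFac.isGloballyFlat_of_balanced hm hn hr hmem hX rfl (hsq hY)
  tfae_finish
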